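/- Let $\Phi\in\mathbb R^{M\times N}$, let $a^\dagger\in\mathbb R^N$ have exactly $S$ non-zero entries, let $\epsilon\in\mathbb R^M$ and $y=\Phi a^\dagger+\epsilon$. Let $\lambda\ge 0$, $\tau>0$, and let $T_\lambda$ be the soft-thresholding function, applied entrywise: $T_\lambda(v)=0$ if $|v|\le\lambda$ and $T_\lambda(v)=v-\lambda\,\mathrm{sign}(v)$ if $|v|>\lambda$. Let $u:[0,\infty)\to\mathbb R^N$ be a solution of the Locally Competitive Algorithm (LCA) $$\tau\dot u(t)=-u(t)-(\Phi^T\Phi-I)\,a(t)+\Phi^Ty,\qquad a(t)=T_\lambda(u(t)),$$ and let $\Gamma(t)=\{n:\ |u_n(t)|>\lambda\}$ be its active set at time $t$. Let $q\ge 0$ be an integer and suppose that $\Phi$ satisfies the restricted isometry property (RIP) with parameters $(S+q,\bar\delta)$, where $0<\bar\delta<1/3$; that is, $(1-\bar\delta)\|x\|_2^2\le\|\Phi x\|_2^2\le(1+\bar\delta)\|x\|_2^2$ for every $x\in\mathbb R^N$ with at most $S+q$ non-zero entries. Suppose that $$\|u(0)\|_2\le\lambda\sqrt q\qquad\text{and}\qquad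 \lambda\sqrt q\ \ge\ \frac{1+\bar\delta}{1-3\bar\delta}\left(\|a^\dagger\|_2+\sqrt{1-\bar\delta}\,\|\epsilon\|_2\right).$$ Then: 1. the active set never contains more than $q$ nodes: $|\Gamma(t)|\le q$ for all $t\ge0$; 2. the LCA converges exponentially fast with speed $(1-\bar\delta)/\tau$: there are a fixed point $u^*$ of the LCA, whose output $a^*=T_\lambda(u^*)$ minimizes $\frac12\|y-\Phi a\|_2^2+\lambda\|a\|_1$ over $a\in\mathbb R^N$, and a constant $K>0$ such that $\|u(t)-u^*\|_2\le K e^{-(1-\bar\delta)t/\tau}$ for all $t\ge0$. -/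

import Mathlib

namespace LCA

noncomputable section

/-- The matrix-vector product, between Euclidean spaces (so that `‖·‖` is the `ℓ₂` norm). -/
def mulE {M N : ℕ} (A : Matrix (Fin M) (Fin N) ℝ) (x : EuclideanSpace ℝ (Fin N)) :
    EuclideanSpace ℝ (Fin M) :=
  WithLp.toLp 2 (A.mulVec x.ofLp)

/-- The `ℓ₀` pseudo-norm: the number of non-zero entries. -/
def l0 {N : ℕ} (x : EuclideanSpace ℝ (Fin N)) : ℕ :=
  (Finset.univ.filter fun n => x n ≠ 0).card

/-- `Φ` satisfies the restricted isometry property with parameters `(k, δ)`. -/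
def RIP {M N : ℕ} (Φ : Matrix (Fin M) (Fin N) ℝ) (k : ℕ) (δ : ℝ) : Prop :=
  0 < δ ∧ δ < 1 ∧ ∀ x : EuclideanSpace ℝ (Fin N), l0 x ≤ k →
    (1 - δ) * ‖x‖ ^ 2 ≤ ‖mulE Φ x‖ ^ 2 ∧ ‖mulE Φ x‖ ^ 2 ≤ (1 + δ) * ‖x‖ ^ 2

/-- The scalar soft-thresholding function `T_λ`. -/
def softThreshold (lam v : ℝ) : ℝ :=
  if |v| ≤ lam then 0 else v - lam * Real.sign v

/-- Soft-thresholding applied to every entry: the output `a` of the internal state `u`. -/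
def output {N : ℕ} (lam : ℝ) (u : EuclideanSpace ℝ (Fin N)) : EuclideanSpace ℝ (Fin N) :=
  WithLp.toLp 2 fun n => softThreshold lam (u n)

/-- The set of active nodes of the internal state `u`. -/
def activeSet {N : ℕ} (lam : ℝ) (u : EuclideanSpace ℝ (Fin N)) : Finset (Fin N) :=
  Finset.univ.filter fun n => lam < |u n|

/-- The right-hand side `-u - (ΦᵀΦ - I) a + Φᵀ y`, with `a = T_λ(u)`, of the LCA equation. -/
def field {M N : ℕ} (Φ : Matrix (Fin M) (Fin N) ℝ) (y : EuclideanSpace ℝ (Fin M)) (lam : ℝ)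
    (u : EuclideanSpace ℝ (Fin N)) : EuclideanSpace ℝ (Fin N) :=
  -u - mulE (Φ.transpose * Φ - 1) (output lam u) + mulE Φ.transpose y

/-- `u` solves `τ u'(t) = -u(t) - (ΦᵀΦ - I) a(t) + Φᵀ y`, `a(t) = T_λ(u(t))`, on `[0, ∞)`
(with the one-sided derivative at `t = 0`). -/
def IsTrajectory {M N : ℕ} (Φ : Matrix (Fin M) (Fin N) ℝ) (y : EuclideanSpace ℝ (Fin M))
    (lam τ : ℝ) (u : ℝ → EuclideanSpace ℝ (Fin N)) : Prop :=
  ∀ t : ℝ, 0 ≤ t → ∃ u' : EuclideanSpace ℝ (Fin N),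
    HasDerivWithinAt u u' (Set.Ici 0) t ∧ τ • u' = field Φ y lam (u t)

/-- The objective `½ ‖y - Φ a‖₂² + λ ‖a‖₁`. -/
def objective {M N : ℕ} (Φ : Matrix (Fin M) (Fin N) ℝ) (y : EuclideanSpace ℝ (Fin M)) (lam : ℝ)
    (a : EuclideanSpace ℝ (Fin N)) : ℝ :=
  1 / 2 * ‖y - mulE Φ a‖ ^ 2 + lam * ∑ n, |a n|

end

end LCA

/-!
The invariant region is the set of states whose `q` largest entries have `ℓ₂` norm at most `λ√q`.
A state in it has fewer than `q` active nodes, so on the boundary a set of `q` entries of maximal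
norm contains all of them. On such a set the Gram matrix is `δ`-close to the identity, and the
threshold condition makes the field point strictly inwards. The same estimate shows that at most
`q` entries of a fixed point in the region reach the threshold.

Convergence follows from LaSalle's principle. The fixed points correspond to the minimizers of the
objective, and the Bregman divergence of `‖T_λ(u)‖² / 2` from a fixed point is a Lyapunov function.
The trajectory is bounded, so the output converges to a minimizer and the state to its fixed point.
Near this limit only the at most `q` entries that reach the threshold there can be active. On these
the restricted isometry gives contraction at rate `(1 - δ) / τ`, and the other entries follow, since
by themselves they relax at the faster rate `1 / τ`.
-/

open Set Filter Topology Asymptotics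

namespace LCA

section DifferentialInequalities

lemma forall_le_of_deriv_right_neg {ι : Type*} [Finite ι] {f f' : ι → ℝ → ℝ} {a b c : ℝ}
    (hab : a ≤ b) (hf : ∀ i, ContinuousOn (f i) (Icc a b))
    (hf' : ∀ i, ∀ x ∈ Ico a b, HasDerivWithinAt (f i) (f' i x) (Ici x) x) (ha : ∀ i, f i a ≤ c)
    (hneg : ∀ x ∈ Ico a b, (∀ i, f i x ≤ c) → ∀ i, f i x = c → f' i x < 0) (i : ι) :
    f i b ≤ c := by
  suffices hsub : Icc a b ⊆ {x | ∀ i, f i x ≤ c} from hsub (right_mem_Icc.2 hab) i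
  refine IsClosed.Icc_subset_of_forall_mem_nhdsWithin ?_ ha ?_
  · have hclosed : IsClosed (Icc a b ∩ ⋂ i, Icc a b ∩ f i ⁻¹' Iic c) :=
      isClosed_Icc.inter <| isClosed_iInter fun i =>
        (hf i).preimage_isClosed_of_isClosed isClosed_Icc isClosed_Iic
    convert hclosed using 1
    ext x
    simp only [mem_inter_iff, mem_ofPred_eq, mem_iInter, mem_preimage, mem_Iic]
    grind
  · rintro x ⟨hx, hxab⟩
    refine eventually_all.2 fun i => ?_
    rcases (hx i).lt_or_eq with hlt | heq
    · have hcont : ContinuousWithinAt (f i) (Ioi x) x :=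
        (hf' i x hxab).continuousWithinAt.mono Ioi_subset_Ici_self
      exact (hcont.eventually_lt_const hlt).mono fun z hz => hz.le
    · have hslope := (hf' i x hxab).Ioi_of_Ici.limsup_slope_le' (lt_irrefl x)
        (hneg x hxab hx i heq)
      filter_upwards [hslope, self_mem_nhdsWithin] with z hz hxz
      rw [slope_def_field, div_lt_iff₀ (sub_pos.2 hxz), zero_mul] at hz
      linarith

lemma norm_le_mul_exp_of_inner_deriv_le {F : Type*} [NormedAddCommGroup F]
    [InnerProductSpace ℝ F] {x x' : ℝ → F} {κ s t : ℝ}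
    (hx : ∀ z, s ≤ z → HasDerivWithinAt x (x' z) (Ici s) z)
    (hx' : ∀ z, s ≤ z → inner ℝ (x z) (x' z) ≤ -(κ * ‖x z‖ ^ 2)) (hst : s ≤ t) :
    ‖x t‖ ≤ ‖x s‖ * Real.exp (-(κ * (t - s))) := by
  have hcont : ContinuousOn (fun z => ‖x z‖ ^ 2) (Icc s t) := fun z hz =>
    (hx z hz.1).norm_sq.continuousWithinAt.mono Icc_subset_Ici_self
  have hgronwall : ‖x t‖ ^ 2 ≤ gronwallBound (‖x s‖ ^ 2) (-(2 * κ)) 0 (t - s) := by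
    refine le_gronwallBound_of_liminf_deriv_right_le hcont (fun z hz _ hr =>
      ((hx z hz.1).norm_sq.mono (Ici_subset_Ici.2 hz.1)).liminf_right_slope_le hr) le_rfl
      (fun z hz => ?_) t (right_mem_Icc.2 hst)
    linarith [hx' z hz.1]
  refine le_of_sq_le_sq (hgronwall.trans_eq ?_) (by positivity)
  rw [gronwallBound_ε0, mul_pow, ← Real.exp_nat_mul]
  push_cast
  ring_nf

variable {E : Type*} [NormedAddCommGroup E] [NormedSpace ℝ E] {x g : ℝ → E} {κ μ η s t : ℝ}

lemma norm_le_of_hasDerivWithinAt_sub_smul (hμ : μ < κ)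
    (hx : ∀ z, s ≤ z → HasDerivWithinAt x (g z - κ • x z) (Ici s) z)
    (hg : ∀ z, s ≤ z → ‖g z‖ ≤ η * Real.exp (-(μ * (z - s)))) (hst : s ≤ t) :
    ‖x t‖ ≤ ‖x s‖ * Real.exp (-(κ * (t - s))) + η / (κ - μ) * Real.exp (-(μ * (t - s))) := by
  have hκμ : 0 < κ - μ := sub_pos.2 hμ
  have hη : 0 ≤ η := by simpa using (norm_nonneg _).trans (hg s le_rfl)
  have hexp (k z : ℝ) :
      HasDerivAt (fun z => Real.exp (k * (z - s))) (k * Real.exp (k * (z - s))) z := by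
    simpa [mul_comm] using (((hasDerivAt_id z).sub_const s).const_mul k).exp
  set p : ℝ → E := fun z => Real.exp (κ * (z - s)) • x z with hp
  set B : ℝ → ℝ := fun z => ‖x s‖ + η / (κ - μ) * Real.exp ((κ - μ) * (z - s)) with hB
  have hp' : ∀ z, s ≤ z → HasDerivWithinAt p (Real.exp (κ * (z - s)) • g z) (Ici s) z :=
    fun z hz => ((hexp κ z).hasDerivWithinAt.smul (hx z hz)).congr_deriv (by module)
  have hB' : ∀ z, HasDerivAt B (η * Real.exp ((κ - μ) * (z - s))) z := fun z =>
    (((hexp (κ - μ) z).const_mul (η / (κ - μ))).const_add ‖x s‖).congr_deriv (by field_simp)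
  have hpB : ‖p t‖ ≤ B t := by
    refine image_norm_le_of_norm_deriv_right_le_deriv_boundary
      (fun z hz => (hp' z hz.1).continuousWithinAt.mono Icc_subset_Ici_self)
      (fun z hz => (hp' z hz.1).mono (Ici_subset_Ici.2 hz.1)) ?_ hB' (fun z hz => ?_)
      (right_mem_Icc.2 hst)
    · simp only [hp, hB, sub_self, mul_zero, Real.exp_zero, one_smul, mul_one]
      exact le_add_of_nonneg_right (by positivity)
    · calc ‖Real.exp (κ * (z - s)) • g z‖
          = Real.exp (κ * (z - s)) * ‖g z‖ := by rw [norm_smul, Real.norm_eq_abs, Real.abs_exp]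
        _ ≤ Real.exp (κ * (z - s)) * (η * Real.exp (-(μ * (z - s)))) := by
          gcongr
          exact hg z hz.1
        _ = η * Real.exp ((κ - μ) * (z - s)) := by
          rw [mul_left_comm, ← Real.exp_add]
          ring_nf
  calc ‖x t‖ = Real.exp (-(κ * (t - s))) * ‖p t‖ := by
        rw [hp, norm_smul, Real.norm_eq_abs, Real.abs_exp, ← mul_assoc, ← Real.exp_add,
          neg_add_cancel, Real.exp_zero, one_mul]
    _ ≤ Real.exp (-(κ * (t - s))) * B t := by gcongr
    _ = _ := by
      rw [hB, mul_add, mul_comm, mul_left_comm, ← Real.exp_add]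
      ring_nf

lemma tendsto_zero_of_hasDerivWithinAt_sub_smul (hκ : 0 < κ)
    (hx : ∀ z, s ≤ z → HasDerivWithinAt x (g z - κ • x z) (Ici s) z)
    (hg : Tendsto g atTop (𝓝 0)) : Tendsto x atTop (𝓝 0) := by
  rw [NormedAddGroup.tendsto_nhds_zero] at hg ⊢
  intro e he
  obtain ⟨a, ha⟩ := eventually_atTop.1 (hg (κ * (e / 2)) (by positivity))
  set b := max a s
  have hx' : ∀ z, b ≤ z → HasDerivWithinAt x (g z - κ • x z) (Ici b) z := fun z hz =>
    (hx z ((le_max_right a s).trans hz)).mono (Ici_subset_Ici.2 (le_max_right a s))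
  have hdecay : Tendsto (fun t => ‖x b‖ * Real.exp (-(κ * (t - b)))) atTop (𝓝 (‖x b‖ * 0)) :=
    (Real.tendsto_exp_neg_atTop_nhds_zero.comp
      ((tendsto_atTop_add_const_right _ (-b) tendsto_id).const_mul_atTop hκ)).const_mul _
  rw [mul_zero] at hdecay
  filter_upwards [hdecay.eventually_lt_const (half_pos he), eventually_ge_atTop b] with t hlt hbt
  have hbound := norm_le_of_hasDerivWithinAt_sub_smul (μ := 0) (η := κ * (e / 2)) hκ hx'
    (fun z hz => by simpa using (ha z ((le_max_left a s).trans hz)).le) hbt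
  have hconst : κ * (e / 2) / (κ - 0) * Real.exp (-(0 * (t - b))) = e / 2 := by
    rw [sub_zero, zero_mul, neg_zero, Real.exp_zero, mul_one, mul_div_cancel_left₀ _ hκ.ne']
  linarith

lemma isBigO_exp_of_hasDerivWithinAt_sub_smul (hμ : μ < κ)
    (hx : ∀ z, s ≤ z → HasDerivWithinAt x (g z - κ • x z) (Ici s) z)
    (hg : g =O[atTop] fun t => Real.exp (-(μ * t))) :
    x =O[atTop] fun t => Real.exp (-(μ * t)) := by
  obtain ⟨C, hC⟩ := hg.bound
  obtain ⟨a, ha⟩ := eventually_atTop.1 hC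
  set b := max a s
  have hx' : ∀ z, b ≤ z → HasDerivWithinAt x (g z - κ • x z) (Ici b) z := fun z hz =>
    (hx z ((le_max_right a s).trans hz)).mono (Ici_subset_Ici.2 (le_max_right a s))
  have hexp (z : ℝ) : Real.exp (-(μ * z)) = Real.exp (-(μ * b)) * Real.exp (-(μ * (z - b))) := by
    rw [← Real.exp_add]
    ring_nf
  have hg' : ∀ z, b ≤ z →
      ‖g z‖ ≤ C * Real.exp (-(μ * b)) * Real.exp (-(μ * (z - b))) := fun z hz => by
    simpa only [Real.norm_eq_abs, Real.abs_exp, mul_assoc, ← hexp] using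
      ha z ((le_max_left a s).trans hz)
  have hshift : x =O[atTop] fun t => Real.exp (-(μ * (t - b))) := by
    refine IsBigO.of_bound (‖x b‖ + C * Real.exp (-(μ * b)) / (κ - μ)) ?_
    filter_upwards [eventually_ge_atTop b] with t ht
    rw [Real.norm_eq_abs, Real.abs_exp, add_mul]
    refine (norm_le_of_hasDerivWithinAt_sub_smul hμ hx' hg' ht).trans ?_
    gcongr
  refine hshift.trans (IsBigO.of_bound (Real.exp (μ * b)) (Eventually.of_forall fun t => ?_))
  rw [Real.norm_eq_abs, Real.norm_eq_abs, Real.abs_exp, Real.abs_exp, ← Real.exp_add]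
  exact le_of_eq (congrArg Real.exp (by ring))

lemma exists_pos_forall_norm_le_of_isBigO {F : Type*} [NormedAddCommGroup F] {x : ℝ → F}
    {f : ℝ → ℝ} (hx : ContinuousOn x (Ici s)) (hf : Continuous f) (hf0 : ∀ t, 0 < f t)
    (h : x =O[atTop] f) :
    ∃ K, 0 < K ∧ ∀ t, s ≤ t → ‖x t‖ ≤ K * f t := by
  obtain ⟨C, hC⟩ := h.bound
  obtain ⟨b, hb⟩ := eventually_atTop.1 hC
  obtain ⟨R, hR⟩ := isCompact_Icc.exists_bound_of_continuousOn (s := Icc s b)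
    ((hx.mono Icc_subset_Ici_self).norm.div hf.continuousOn fun t _ => (hf0 t).ne')
  refine ⟨max (max C R) 1, by positivity, fun t hst => ?_⟩
  have hCR : ‖x t‖ ≤ max C R * f t := by
    rcases le_total b t with hbt | htb
    · refine (hb t hbt).trans ?_
      rw [Real.norm_of_nonneg (hf0 t).le]
      exact mul_le_mul_of_nonneg_right (le_max_left C R) (hf0 t).le
    · have hRt : ‖x t‖ / f t ≤ R := (le_abs_self _).trans (hR t ⟨hst, htb⟩)
      rw [div_le_iff₀ (hf0 t)] at hRt
      exact hRt.trans (mul_le_mul_of_nonneg_right (le_max_right C R) (hf0 t).le)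
  exact hCR.trans (mul_le_mul_of_nonneg_right (le_max_left _ 1) (hf0 t).le)

end DifferentialInequalities

section SoftThreshold

variable {lam : ℝ}

lemma softThreshold_eq_zero_iff (hlam : 0 ≤ lam) {v : ℝ} :
    softThreshold lam v = 0 ↔ |v| ≤ lam := by
  refine ⟨fun h => ?_, fun h => if_pos h⟩
  by_contra! hv
  rw [softThreshold, if_neg hv.not_ge, sub_eq_zero] at h
  have habs : |v| ≤ lam := by
    rcases Real.sign_apply_eq v with hs | hs | hs <;> rw [h, hs] <;> simp [abs_of_nonneg hlam, hlam]
  exact hv.not_ge habs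

lemma abs_sub_softThreshold_le (hlam : 0 ≤ lam) (v : ℝ) : |v - softThreshold lam v| ≤ lam := by
  rw [softThreshold]
  split_ifs with hv
  · rwa [sub_zero]
  · rw [sub_sub_cancel]
    rcases Real.sign_apply_eq v with hs | hs | hs <;> simp [hs, abs_of_nonneg hlam, hlam]

lemma sub_softThreshold_mul_softThreshold (hlam : 0 ≤ lam) (v : ℝ) :
    (v - softThreshold lam v) * softThreshold lam v = lam * |softThreshold lam v| := by
  rw [softThreshold]
  split_ifs with hv
  · simp
  · rw [not_le] at hv
    rcases lt_or_gt_of_ne (abs_pos.1 (hlam.trans_lt hv)) with hneg | hpos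
    · rw [abs_of_neg hneg] at hv
      rw [Real.sign_of_neg hneg, abs_of_neg (by linarith)]
      ring
    · rw [abs_of_pos hpos] at hv
      rw [Real.sign_of_pos hpos, abs_of_pos (by linarith)]
      ring

/- `softThreshold lam` is the proximal map of `lam * |·|`: `v - softThreshold lam v` is a
subgradient of `lam * |·|` at `softThreshold lam v`. -/
lemma sub_softThreshold_mul_le (hlam : 0 ≤ lam) (v s : ℝ) :
    (v - softThreshold lam v) * (s - softThreshold lam v) ≤
      lam * |s| - lam * |softThreshold lam v| := by
  have hs : (v - softThreshold lam v) * s ≤ lam * |s| :=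
    (le_abs_self _).trans <| (abs_mul _ _).trans_le <|
      mul_le_mul_of_nonneg_right (abs_sub_softThreshold_le hlam v) (abs_nonneg s)
  rw [mul_sub, sub_softThreshold_mul_softThreshold hlam]
  linarith

lemma softThreshold_sub_mul_nonneg (hlam : 0 ≤ lam) (v w : ℝ) :
    0 ≤ (softThreshold lam v - softThreshold lam w) *
      ((v - w) - (softThreshold lam v - softThreshold lam w)) := by
  linarith [sub_softThreshold_mul_le hlam v (softThreshold lam w),
    sub_softThreshold_mul_le hlam w (softThreshold lam v)]

lemma abs_softThreshold_sub_le (hlam : 0 ≤ lam) (v w : ℝ) :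
    |softThreshold lam v - softThreshold lam w| ≤ |v - w| := by
  have hmono := softThreshold_sub_mul_nonneg hlam v w
  refine sq_le_sq.1 ?_
  linarith [sq_nonneg ((v - w) - (softThreshold lam v - softThreshold lam w))]

lemma abs_softThreshold_le (hlam : 0 ≤ lam) (v : ℝ) : |softThreshold lam v| ≤ |v| := by
  have hzero : softThreshold lam 0 = 0 :=
    (softThreshold_eq_zero_iff hlam).2 (abs_zero.trans_le hlam)
  simpa only [hzero, sub_zero] using abs_softThreshold_sub_le hlam v 0

lemma continuous_softThreshold (hlam : 0 ≤ lam) : Continuous (softThreshold lam) :=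
  (LipschitzWith.of_dist_le_mul (K := 1) fun v w => by
    simpa [Real.dist_eq] using abs_softThreshold_sub_le hlam v w).continuous

/-- The Bregman divergence at `v` and `w` of the function `v ↦ softThreshold lam v ^ 2 / 2`,
whose derivative is `softThreshold lam`. Sums of it over the coordinates are the Lyapunov
functions of the dynamics. -/
noncomputable def bregman (lam v w : ℝ) : ℝ :=
  softThreshold lam v ^ 2 / 2 - softThreshold lam w ^ 2 / 2 - softThreshold lam w * (v - w)

lemma half_sq_le_bregman (hlam : 0 ≤ lam) (v w : ℝ) :
    (softThreshold lam v - softThreshold lam w) ^ 2 / 2 ≤ bregman lam v w := by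
  have hsub : 0 ≤ softThreshold lam w *
      ((w - softThreshold lam w) - (v - softThreshold lam v)) := by
    have hvw : (v - softThreshold lam v) * softThreshold lam w ≤ lam * |softThreshold lam w| := by
      linarith [sub_softThreshold_mul_le hlam v (softThreshold lam w),
        sub_softThreshold_mul_softThreshold hlam v]
    linarith [sub_softThreshold_mul_softThreshold hlam w]
  unfold bregman
  linarith

lemma bregman_nonneg (hlam : 0 ≤ lam) (v w : ℝ) : 0 ≤ bregman lam v w :=
  (by positivity : (0 : ℝ) ≤ (softThreshold lam v - softThreshold lam w) ^ 2 / 2).trans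
    (half_sq_le_bregman hlam v w)

lemma bregman_add_bregman_swap (lam v w : ℝ) :
    bregman lam v w + bregman lam w v =
      (softThreshold lam v - softThreshold lam w) * (v - w) := by
  unfold bregman
  ring

lemma bregman_eq_zero (hlam : 0 ≤ lam) {v w : ℝ} (h : softThreshold lam v = softThreshold lam w) :
    bregman lam v w = 0 := by
  have hswap := bregman_add_bregman_swap lam v w
  rw [h, sub_self, zero_mul] at hswap
  linarith [bregman_nonneg hlam v w, bregman_nonneg hlam w v]

lemma bregman_le_sq (hlam : 0 ≤ lam) (v w : ℝ) : bregman lam v w ≤ (v - w) ^ 2 := by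
  calc bregman lam v w ≤ (softThreshold lam v - softThreshold lam w) * (v - w) := by
        linarith [bregman_add_bregman_swap lam v w, bregman_nonneg hlam w v]
    _ ≤ |softThreshold lam v - softThreshold lam w| * |v - w| :=
        (le_abs_self _).trans_eq (abs_mul _ _)
    _ ≤ |v - w| * |v - w| :=
        mul_le_mul_of_nonneg_right (abs_softThreshold_sub_le hlam v w) (abs_nonneg _)
    _ = (v - w) ^ 2 := by rw [abs_mul_abs_self, sq]

lemma hasDerivAt_bregman (hlam : 0 ≤ lam) (v w : ℝ) :
    HasDerivAt (fun x => bregman lam x w) (softThreshold lam v - softThreshold lam w) v := by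
  have hself : HasDerivAt (fun x => bregman lam x v) 0 v := by
    have hsq : (fun x => bregman lam x v) =O[𝓝 v] fun x => ‖x - v‖ ^ 2 :=
      IsBigO.of_norm_le fun x => by
        rw [Real.norm_of_nonneg (bregman_nonneg hlam x v), Real.norm_eq_abs, sq_abs]
        exact bregman_le_sq hlam x v
    simpa using (hsq.hasFDerivAt one_lt_two).hasDerivAt
  have hlin : HasDerivAt
      (fun x => bregman lam v w + (softThreshold lam v - softThreshold lam w) * (x - v))
      (softThreshold lam v - softThreshold lam w) v := by
    simpa using (((hasDerivAt_id v).sub_const v).const_mul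
      (softThreshold lam v - softThreshold lam w)).const_add (bregman lam v w)
  refine ((hself.add hlin).congr_deriv (zero_add _)).congr_of_eventuallyEq
    (Eventually.of_forall fun x => ?_)
  simp only [bregman, Pi.add_apply]
  ring

end SoftThreshold

section EuclideanSpace

variable {M N : ℕ}

lemma mulE_add (A : Matrix (Fin M) (Fin N) ℝ) (x z : EuclideanSpace ℝ (Fin N)) :
    mulE A (x + z) = mulE A x + mulE A z :=
  map_add (Matrix.toEuclideanLin A) x z

lemma mulE_sub (A : Matrix (Fin M) (Fin N) ℝ) (x z : EuclideanSpace ℝ (Fin N)) :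
    mulE A (x - z) = mulE A x - mulE A z :=
  map_sub (Matrix.toEuclideanLin A) x z

lemma mulE_smul (A : Matrix (Fin M) (Fin N) ℝ) (c : ℝ) (x : EuclideanSpace ℝ (Fin N)) :
    mulE A (c • x) = c • mulE A x :=
  map_smul (Matrix.toEuclideanLin A) c x

lemma mulE_zero (A : Matrix (Fin M) (Fin N) ℝ) : mulE A 0 = 0 :=
  map_zero (Matrix.toEuclideanLin A)

lemma continuous_mulE (A : Matrix (Fin M) (Fin N) ℝ) : Continuous (mulE A) :=
  (Matrix.toEuclideanLin A).continuous_of_finiteDimensional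

lemma isBigO_mulE {α : Type*} (A : Matrix (Fin M) (Fin N) ℝ) (x : α → EuclideanSpace ℝ (Fin N))
    (l : Filter α) : (fun t => mulE A (x t)) =O[l] x :=
  (LinearMap.toContinuousLinearMap (Matrix.toEuclideanLin A)).isBigO_comp x l

lemma inner_mulE_transpose (A : Matrix (Fin M) (Fin N) ℝ) (x : EuclideanSpace ℝ (Fin N))
    (z : EuclideanSpace ℝ (Fin M)) :
    inner ℝ x (mulE A.transpose z) = inner ℝ (mulE A x) z := by
  simp only [EuclideanSpace.inner_eq_star_dotProduct, mulE, star_trivial]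
  rw [Matrix.mulVec_transpose, ← Matrix.dotProduct_mulVec]

lemma mulE_gram_sub_one (A : Matrix (Fin M) (Fin N) ℝ) (x : EuclideanSpace ℝ (Fin N)) :
    mulE (A.transpose * A - 1) x = mulE A.transpose (mulE A x) - x := by
  ext n
  simp [mulE, Matrix.sub_mulVec, Matrix.mulVec_mulVec]

variable {ι : Type*} [Fintype ι]

lemma real_inner_eq_sum (x z : EuclideanSpace ℝ ι) : inner ℝ x z = ∑ n, x n * z n := by
  simp only [PiLp.inner_apply, RCLike.inner_apply, conj_trivial, mul_comm]

lemma norm_le_sum_abs (x : EuclideanSpace ℝ ι) : ‖x‖ ≤ ∑ n, |x n| := by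
  refine le_of_sq_le_sq ?_ (Finset.sum_nonneg fun n _ => abs_nonneg _)
  rw [EuclideanSpace.real_norm_sq_eq]
  simp only [← sq_abs (x _)]
  exact Finset.sum_sq_le_sq_sum_of_nonneg fun n _ => abs_nonneg _

variable [DecidableEq ι]

/-- The coordinate projection which keeps the entries of a vector in `s` and sets the others
to `0`. -/
noncomputable def restrict (s : Finset ι) : EuclideanSpace ℝ ι →L[ℝ] EuclideanSpace ℝ ι :=
  LinearMap.toContinuousLinearMap
    { toFun := fun x => WithLp.toLp 2 fun n => if n ∈ s then x n else 0
      map_add' := fun x z => by ext n; simp [ite_add_zero]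
      map_smul' := fun c x => by ext n; simp }

lemma restrict_apply (s : Finset ι) (x : EuclideanSpace ℝ ι) (n : ι) :
    restrict s x n = if n ∈ s then x n else 0 :=
  rfl

lemma restrict_eq_self {s : Finset ι} {x : EuclideanSpace ℝ ι} (h : ∀ n ∉ s, x n = 0) :
    restrict s x = x := by
  ext n
  rw [restrict_apply]
  split_ifs with hn
  exacts [rfl, (h n hn).symm]

lemma restrict_apply_of_notMem {s : Finset ι} {n : ι} (hn : n ∉ s) (x : EuclideanSpace ℝ ι) :
    restrict s x n = 0 :=
  if_neg hn

lemma norm_restrict_sq (s : Finset ι) (x : EuclideanSpace ℝ ι) :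
    ‖restrict s x‖ ^ 2 = ∑ n ∈ s, x n ^ 2 := by
  simp [EuclideanSpace.real_norm_sq_eq, restrict_apply, ite_pow]

lemma inner_restrict_left (s : Finset ι) (x z : EuclideanSpace ℝ ι) :
    inner ℝ (restrict s x) z = ∑ n ∈ s, x n * z n := by
  simp [real_inner_eq_sum, restrict_apply]

lemma inner_restrict_self (s : Finset ι) (x : EuclideanSpace ℝ ι) :
    inner ℝ (restrict s x) x = ‖restrict s x‖ ^ 2 := by
  rw [inner_restrict_left, norm_restrict_sq]
  exact Finset.sum_congr rfl fun n _ => (sq (x n)).symm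

lemma inner_restrict_restrict (s : Finset ι) (x z : EuclideanSpace ℝ ι) :
    inner ℝ (restrict s x) (restrict s z) = inner ℝ (restrict s x) z := by
  rw [inner_restrict_left, inner_restrict_left]
  exact Finset.sum_congr rfl fun n hn => by rw [restrict_apply, if_pos hn]

lemma norm_restrict_le (s : Finset ι) (x : EuclideanSpace ℝ ι) : ‖restrict s x‖ ≤ ‖x‖ := by
  refine le_of_sq_le_sq ?_ (norm_nonneg x)
  rw [norm_restrict_sq, EuclideanSpace.real_norm_sq_eq]
  exact Finset.sum_le_univ_sum_of_nonneg fun n => sq_nonneg _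

lemma norm_le_norm_restrict {s : Finset ι} {x z : EuclideanSpace ℝ ι}
    (hz : ∀ n ∉ s, z n = 0) (hzx : ∀ n ∈ s, |z n| ≤ |x n|) : ‖z‖ ≤ ‖restrict s x‖ := by
  refine le_of_sq_le_sq ?_ (norm_nonneg _)
  rw [← restrict_eq_self hz, norm_restrict_sq, norm_restrict_sq]
  exact Finset.sum_le_sum fun n hn => sq_le_sq.2 (hzx n hn)

lemma norm_restrict_insert_sq {s : Finset ι} {n : ι} (hn : n ∉ s) (x : EuclideanSpace ℝ ι) :
    ‖restrict (insert n s) x‖ ^ 2 = x n ^ 2 + ‖restrict s x‖ ^ 2 := by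
  rw [norm_restrict_sq, Finset.sum_insert hn, norm_restrict_sq]

end EuclideanSpace

section Output

variable {M N : ℕ} {Φ : Matrix (Fin M) (Fin N) ℝ} {y : EuclideanSpace ℝ (Fin M)} {lam : ℝ}

lemma output_apply (lam : ℝ) (u : EuclideanSpace ℝ (Fin N)) (n : Fin N) :
    output lam u n = softThreshold lam (u n) :=
  rfl

lemma mem_activeSet {u : EuclideanSpace ℝ (Fin N)} {n : Fin N} :
    n ∈ activeSet lam u ↔ lam < |u n| := by
  rw [activeSet, Finset.mem_filter_univ]

lemma output_apply_eq_zero_iff (hlam : 0 ≤ lam) {u : EuclideanSpace ℝ (Fin N)} {n : Fin N} :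
    output lam u n = 0 ↔ n ∉ activeSet lam u := by
  rw [output_apply, softThreshold_eq_zero_iff hlam, mem_activeSet, not_lt]

lemma output_zero (hlam : 0 ≤ lam) : output lam (0 : EuclideanSpace ℝ (Fin N)) = 0 := by
  ext n
  simpa [output_apply_eq_zero_iff hlam, mem_activeSet] using hlam

lemma activeSet_zero (hlam : 0 ≤ lam) : activeSet lam (0 : EuclideanSpace ℝ (Fin N)) = ∅ :=
  Finset.filter_false_of_mem fun n _ => by simpa using hlam

lemma continuous_output (hlam : 0 ≤ lam) : Continuous (output lam (N := N)) :=
  (PiLp.continuous_toLp 2 _).comp <| continuous_pi fun n =>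
    (continuous_softThreshold hlam).comp (PiLp.continuous_apply 2 _ n)

lemma field_eq (Φ : Matrix (Fin M) (Fin N) ℝ) (y : EuclideanSpace ℝ (Fin M)) (lam : ℝ)
    (u : EuclideanSpace ℝ (Fin N)) :
    field Φ y lam u =
      (-u + output lam u - mulE Φ.transpose (mulE Φ (output lam u))) + mulE Φ.transpose y := by
  rw [field, mulE_gram_sub_one]
  abel

lemma field_eq_zero_iff {u : EuclideanSpace ℝ (Fin N)} :
    field Φ y lam u = 0 ↔ u - output lam u = mulE Φ.transpose (y - mulE Φ (output lam u)) := by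
  rw [field_eq, mulE_sub, ← sub_eq_zero (a := u - _), ← neg_eq_zero]
  abel_nf

lemma field_sub_field (u w : EuclideanSpace ℝ (Fin N)) :
    field Φ y lam u - field Φ y lam w =
      -(u - w) - mulE (Φ.transpose * Φ - 1) (output lam u - output lam w) := by
  rw [field, field, mulE_sub]
  abel

end Output

section RestrictedIsometry

variable {M N k q : ℕ} {Φ : Matrix (Fin M) (Fin N) ℝ} {δ : ℝ}

lemma l0_le_card {s : Finset (Fin N)} {x : EuclideanSpace ℝ (Fin N)} (h : ∀ n ∉ s, x n = 0) :
    l0 x ≤ s.card :=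
  Finset.card_le_card fun n hn => by_contra fun hns => (Finset.mem_filter.1 hn).2 (h n hns)

lemma RIP.mono (h : RIP Φ k δ) (hqk : q ≤ k) : RIP Φ q δ :=
  ⟨h.1, h.2.1, fun x hx => h.2.2 x (hx.trans hqk)⟩

lemma RIP.norm_mulE_le (h : RIP Φ k δ) {x : EuclideanSpace ℝ (Fin N)} (hx : l0 x ≤ k) :
    ‖mulE Φ x‖ ≤ √(1 + δ) * ‖x‖ := by
  have hδ := h.1
  refine le_of_sq_le_sq ?_ (by positivity)
  rw [mul_pow, Real.sq_sqrt (by positivity)]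
  exact (h.2.2 x hx).2

lemma RIP.inner_sub_inner_le (h : RIP Φ k δ) {s : Finset (Fin N)} (hs : s.card ≤ k)
    {x z : EuclideanSpace ℝ (Fin N)} (hx : ∀ n ∉ s, x n = 0) (hz : ∀ n ∉ s, z n = 0) :
    inner ℝ x z - inner ℝ (mulE Φ x) (mulE Φ z) ≤ δ / 2 * (‖x‖ ^ 2 + ‖z‖ ^ 2) := by
  have hadd := (h.2.2 (x + z) ((l0_le_card fun n hn => by simp [hx n hn, hz n hn]).trans hs)).1
  have hsub := (h.2.2 (x - z) ((l0_le_card fun n hn => by simp [hx n hn, hz n hn]).trans hs)).2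
  rw [mulE_add, norm_add_sq_real, norm_add_sq_real] at hadd
  rw [mulE_sub, norm_sub_sq_real, norm_sub_sq_real] at hsub
  linarith

lemma RIP.inner_restrict_gram_le (h : RIP Φ k δ) {s : Finset (Fin N)} (hs : s.card ≤ k)
    {v z : EuclideanSpace ℝ (Fin N)} (hz : ∀ n ∉ s, z n = 0) (hzv : ∀ n ∈ s, |z n| ≤ |v n|) :
    inner ℝ (restrict s v) (-v + z - mulE Φ.transpose (mulE Φ z)) ≤
      -((1 - δ) * ‖restrict s v‖ ^ 2) := by
  have hδ := h.1
  have hnorm : ‖z‖ ^ 2 ≤ ‖restrict s v‖ ^ 2 := by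
    gcongr
    exact norm_le_norm_restrict hz hzv
  have hpolar := h.inner_sub_inner_le hs (fun n hn => restrict_apply_of_notMem hn v) hz
  rw [inner_sub_right, inner_add_right, inner_neg_right, inner_restrict_self,
    inner_mulE_transpose]
  linarith [mul_le_mul_of_nonneg_left hnorm hδ.le]

lemma RIP.inner_restrict_field_neg (h : RIP Φ k δ) {y : EuclideanSpace ℝ (Fin M)} {lam c : ℝ}
    (hlam : 0 ≤ lam) (hy : √(1 + δ) * ‖y‖ < (1 - δ) * c) {s : Finset (Fin N)} (hs : s.card ≤ k)
    {v : EuclideanSpace ℝ (Fin N)} (hv : activeSet lam v ⊆ s) (hc : c ≤ ‖restrict s v‖) :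
    inner ℝ (restrict s v) (field Φ y lam v) < 0 := by
  have hδ : 0 < 1 - δ := sub_pos.2 h.2.1
  have hgram := h.inner_restrict_gram_le hs (v := v) (z := output lam v)
    (fun n hn => (output_apply_eq_zero_iff hlam).2 fun hnv => hn (hv hnv))
    (fun n _ => abs_softThreshold_le hlam (v n))
  have hinput : inner ℝ (restrict s v) (mulE Φ.transpose y) ≤
      √(1 + δ) * ‖y‖ * ‖restrict s v‖ := by
    rw [inner_mulE_transpose]
    refine (real_inner_le_norm _ _).trans ?_
    have hΦ := h.norm_mulE_le
      ((l0_le_card fun n hn => restrict_apply_of_notMem hn v).trans hs)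
    exact (mul_le_mul_of_nonneg_right hΦ (norm_nonneg y)).trans_eq (by ring)
  have hlt : √(1 + δ) * ‖y‖ < (1 - δ) * ‖restrict s v‖ :=
    hy.trans_le (mul_le_mul_of_nonneg_left hc hδ.le)
  have hpos : 0 < ‖restrict s v‖ :=
    pos_of_mul_pos_right ((by positivity : 0 ≤ √(1 + δ) * ‖y‖).trans_lt hlt) hδ.le
  rw [field_eq, inner_add_right]
  linarith [mul_lt_mul_of_pos_right hlt hpos]

end RestrictedIsometry

section InvariantRegion

variable {ι : Type*} [Fintype ι] [DecidableEq ι]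

/-- The closed ball of radius `c` for the `ℓ₂` norm of the `q` entries of largest modulus, written
as an intersection over all choices of at most `q` entries. It is the invariant region of the
dynamics. -/
def topBall (q : ℕ) (c : ℝ) : Set (EuclideanSpace ℝ ι) :=
  {v | ∀ s : Finset ι, s.card ≤ q → ‖restrict s v‖ ≤ c}

variable {q : ℕ} {c : ℝ}

lemma isClosed_topBall : IsClosed (topBall q c : Set (EuclideanSpace ℝ ι)) := by
  simp only [topBall, ofPred_forall]
  exact isClosed_iInter fun s => isClosed_iInter fun _ =>
    isClosed_le (restrict s).continuous.norm continuous_const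

lemma isBounded_topBall (hq : 0 < q) :
    Bornology.IsBounded (topBall q c : Set (EuclideanSpace ℝ ι)) := by
  refine isBounded_iff_forall_norm_le.2 ⟨∑ _n : ι, c, fun v hv => ?_⟩
  refine (norm_le_sum_abs v).trans (Finset.sum_le_sum fun n _ => ?_)
  have hn := hv {n} ((Finset.card_singleton n).trans_le hq)
  refine (sq_le_sq.1 ?_).trans ((abs_norm _).trans_le hn)
  rw [norm_restrict_sq, Finset.sum_singleton]

lemma mem_topBall_of_norm_le {v : EuclideanSpace ℝ ι} (hv : ‖v‖ ≤ c) : v ∈ topBall q c :=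
  fun s _ => (norm_restrict_le s v).trans hv

variable {M N : ℕ} {Φ : Matrix (Fin M) (Fin N) ℝ} {y : EuclideanSpace ℝ (Fin M)} {lam τ : ℝ}

lemma mul_sqrt_card_le_norm_restrict (hlam : 0 ≤ lam) {s : Finset ι} {v : EuclideanSpace ℝ ι}
    (hv : ∀ n ∈ s, lam ≤ |v n|) : lam * √s.card ≤ ‖restrict s v‖ := by
  refine le_of_sq_le_sq ?_ (norm_nonneg _)
  rw [mul_pow, Real.sq_sqrt (Nat.cast_nonneg _), norm_restrict_sq, mul_comm, ← nsmul_eq_mul]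
  exact Finset.card_nsmul_le_sum _ _ _ fun n hn =>
    sq_le_sq.2 ((abs_of_nonneg hlam).trans_le (hv n hn))

lemma mul_sqrt_card_lt_norm_restrict (hlam : 0 ≤ lam) {s : Finset ι} {v : EuclideanSpace ℝ ι}
    (hs : s.Nonempty) (hv : ∀ n ∈ s, lam < |v n|) : lam * √s.card < ‖restrict s v‖ := by
  refine lt_of_pow_lt_pow_left₀ 2 (norm_nonneg _) ?_
  rw [mul_pow, Real.sq_sqrt (Nat.cast_nonneg _), norm_restrict_sq, mul_comm, ← nsmul_eq_mul,
    ← Finset.sum_const]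
  exact Finset.sum_lt_sum_of_nonempty hs fun n hn =>
    sq_lt_sq.2 ((abs_of_nonneg hlam).trans_lt (hv n hn))

lemma card_activeSet_lt (hq : 0 < q) (hlam : 0 ≤ lam) {v : EuclideanSpace ℝ (Fin N)}
    (hv : v ∈ topBall q (lam * √q)) : (activeSet lam v).card < q := by
  by_contra! hcard
  obtain ⟨s, hs, rfl⟩ := Finset.exists_subset_card_eq hcard
  exact (hv s le_rfl).not_gt <| mul_sqrt_card_lt_norm_restrict hlam (Finset.card_pos.1 hq)
    fun n hn => mem_activeSet.1 (hs hn)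

lemma activeSet_subset_of_forall_norm_restrict_le (hlam : 0 ≤ lam) {v : EuclideanSpace ℝ (Fin N)}
    {s : Finset (Fin N)} (hs : s.card ≤ q) (hcard : (activeSet lam v).card < q)
    (hmax : ∀ s' : Finset (Fin N), s'.card ≤ q → ‖restrict s' v‖ ≤ ‖restrict s v‖) :
    activeSet lam v ⊆ s := by
  by_contra hsub
  obtain ⟨m, hm, hms⟩ := Finset.not_subset.1 hsub
  have hm_sq : lam ^ 2 < v m ^ 2 :=
    sq_lt_sq.2 ((abs_of_nonneg hlam).trans_lt (mem_activeSet.1 hm))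
  have hmax_sq (s' : Finset (Fin N)) (hs' : s'.card ≤ q) :
      ‖restrict s' v‖ ^ 2 ≤ ‖restrict s v‖ ^ 2 :=
    pow_le_pow_left₀ (norm_nonneg _) (hmax s' hs') 2
  rcases hs.lt_or_eq with hlt | rfl
  · have hinsert := hmax_sq (insert m s) ((Finset.card_insert_le _ _).trans hlt)
    rw [norm_restrict_insert_sq hms] at hinsert
    linarith [sq_nonneg lam]
  · obtain ⟨k, hks, hk⟩ : ∃ k ∈ s, k ∉ activeSet lam v :=
      Finset.exists_mem_notMem_of_card_lt_card hcard
    have hk_sq : v k ^ 2 ≤ lam ^ 2 :=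
      sq_le_sq.2 ((not_lt.1 fun h => hk (mem_activeSet.2 h)).trans_eq (abs_of_nonneg hlam).symm)
    have hmk : m ∉ s.erase k := fun h => hms (Finset.mem_of_mem_erase h)
    have hswap := hmax_sq (insert m (s.erase k))
      ((Finset.card_insert_of_notMem hmk).trans (Finset.card_erase_add_one hks)).le
    rw [norm_restrict_insert_sq hmk, ← Finset.insert_erase hks,
      norm_restrict_insert_sq (Finset.notMem_erase k s), Finset.insert_erase hks] at hswap
    linarith

lemma activeSet_subset_filter_le (lam : ℝ) (w : EuclideanSpace ℝ (Fin N)) :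
    activeSet lam w ⊆ Finset.univ.filter fun n => lam ≤ |w n| :=
  Finset.monotone_filter_right _ fun _ _ hn => hn.le

lemma card_le_of_field_eq_zero (hlam : 0 ≤ lam)
    (hinward : ∀ (v : EuclideanSpace ℝ (Fin N)) (s : Finset (Fin N)), s.card ≤ q →
      activeSet lam v ⊆ s → lam * √q ≤ ‖restrict s v‖ →
      inner ℝ (restrict s v) (field Φ y lam v) < 0)
    {w : EuclideanSpace ℝ (Fin N)} (hw : field Φ y lam w = 0) (hq : (activeSet lam w).card ≤ q) :
    (Finset.univ.filter fun n => lam ≤ |w n|).card ≤ q := by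
  by_contra! hcard
  obtain ⟨s, hws, hs, rfl⟩ := Finset.exists_subsuperset_card_eq
    (activeSet_subset_filter_le lam w) hq hcard.le
  refine (hinward w s le_rfl hws ?_).ne (by rw [hw, inner_zero_right])
  exact mul_sqrt_card_le_norm_restrict hlam fun n hn => (Finset.mem_filter_univ n).1 (hs hn)

variable {u : ℝ → EuclideanSpace ℝ (Fin N)}

lemma IsTrajectory.hasDerivWithinAt (hu : IsTrajectory Φ y lam τ u) (hτ : τ ≠ 0) {t : ℝ}
    (ht : 0 ≤ t) : HasDerivWithinAt u (τ⁻¹ • field Φ y lam (u t)) (Ici 0) t := by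
  obtain ⟨u', hu', hfield⟩ := hu t ht
  rwa [← hfield, inv_smul_smul₀ hτ]

lemma IsTrajectory.continuousOn (hu : IsTrajectory Φ y lam τ u) : ContinuousOn u (Ici 0) :=
  fun t ht => let ⟨_, hu', _⟩ := hu t ht; hu'.continuousWithinAt

lemma IsTrajectory.mem_topBall (hu : IsTrajectory Φ y lam τ u) (hτ : 0 < τ)
    (hinward : ∀ v ∈ topBall q c, ∀ s : Finset (Fin N), s.card ≤ q → ‖restrict s v‖ = c →
      inner ℝ (restrict s v) (field Φ y lam v) < 0)
    (hu0 : u 0 ∈ topBall q c) {t : ℝ} (ht : 0 ≤ t) : u t ∈ topBall q c := by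
  intro s hs
  have hc : 0 ≤ c := (norm_nonneg _).trans (hu0 ∅ (Nat.zero_le q))
  have hderiv (s : {s : Finset (Fin N) // s.card ≤ q}) (x : ℝ) (hx : 0 ≤ x) :
      HasDerivWithinAt (fun x => ‖restrict s.1 (u x)‖ ^ 2)
        (2 * inner ℝ (restrict s.1 (u x)) (restrict s.1 (τ⁻¹ • field Φ y lam (u x)))) (Ici 0) x :=
    ((restrict s.1).hasFDerivAt.comp_hasDerivWithinAt x (hu.hasDerivWithinAt hτ.ne' hx)).norm_sq
  refine le_of_sq_le_sq (forall_le_of_deriv_right_neg (c := c ^ 2) ht (fun s x hx =>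
    (hderiv s x hx.1).continuousWithinAt.mono Icc_subset_Ici_self) (fun s x hx =>
    (hderiv s x hx.1).mono (Ici_subset_Ici.2 hx.1)) (fun s => ?_) ?_ ⟨s, hs⟩) hc
  · exact pow_le_pow_left₀ (norm_nonneg _) (hu0 s.1 s.2) 2
  · rintro x - hx s hsx
    have hmem : u x ∈ topBall q c := fun s hs => le_of_sq_le_sq (hx ⟨s, hs⟩) hc
    rw [inner_restrict_restrict, real_inner_smul_right]
    exact mul_neg_of_pos_of_neg two_pos <| mul_neg_of_pos_of_neg (inv_pos.2 hτ) <|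
      hinward (u x) hmem s.1 s.2 ((sq_eq_sq₀ (norm_nonneg _) hc).1 hsx)

end InvariantRegion

section Optimality

variable {M N : ℕ} {Φ : Matrix (Fin M) (Fin N) ℝ} {y : EuclideanSpace ℝ (Fin M)} {lam : ℝ}

lemma inner_sub_output_le (hlam : 0 ≤ lam) (u x : EuclideanSpace ℝ (Fin N)) :
    inner ℝ (x - output lam u) (u - output lam u) ≤
      lam * ∑ n, |x n| - lam * ∑ n, |output lam u n| := by
  rw [real_inner_eq_sum, Finset.mul_sum, Finset.mul_sum, ← Finset.sum_sub_distrib]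
  exact Finset.sum_le_sum fun n _ =>
    (mul_comm _ _).trans_le (sub_softThreshold_mul_le hlam (u n) (x n))

lemma objective_sub_objective (Φ : Matrix (Fin M) (Fin N) ℝ) (y : EuclideanSpace ℝ (Fin M))
    (lam : ℝ) (x a : EuclideanSpace ℝ (Fin N)) :
    objective Φ y lam x - objective Φ y lam a =
      1 / 2 * ‖mulE Φ (x - a)‖ ^ 2 - inner ℝ (x - a) (mulE Φ.transpose (y - mulE Φ a)) +
        (lam * ∑ n, |x n| - lam * ∑ n, |a n|) := by
  have hres : y - mulE Φ x = (y - mulE Φ a) - mulE Φ (x - a) := by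
    rw [mulE_sub]
    abel
  rw [objective, objective, hres, norm_sub_sq_real (y - mulE Φ a), real_inner_comm,
    inner_mulE_transpose]
  ring

lemma isMinOn_objective_output (hlam : 0 ≤ lam) {w : EuclideanSpace ℝ (Fin N)}
    (hw : field Φ y lam w = 0) : IsMinOn (objective Φ y lam) univ (output lam w) := by
  refine isMinOn_univ_iff.2 fun x => sub_nonneg.1 ?_
  rw [objective_sub_objective, ← field_eq_zero_iff.1 hw]
  have hsub := inner_sub_output_le hlam w x
  have hquad : 0 ≤ 1 / 2 * ‖mulE Φ (x - output lam w)‖ ^ 2 := by positivity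
  linarith

lemma continuous_objective (Φ : Matrix (Fin M) (Fin N) ℝ) (y : EuclideanSpace ℝ (Fin M))
    (lam : ℝ) : Continuous (objective Φ y lam) :=
  (((continuous_const.sub (continuous_mulE Φ)).norm.pow 2).const_mul _).add <|
    (continuous_finsetSum _ fun n _ => (PiLp.continuous_apply 2 _ n).abs).const_mul _

lemma exists_isMinOn_objective (Φ : Matrix (Fin M) (Fin N) ℝ) (y : EuclideanSpace ℝ (Fin M))
    (hlam : 0 < lam) : ∃ a, IsMinOn (objective Φ y lam) univ a := by
  have hcoercive : Tendsto (objective Φ y lam) (cocompact _) atTop := by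
    refine tendsto_atTop_mono (fun x => ?_) (tendsto_norm_cocompact_atTop.const_mul_atTop hlam)
    have hl1 := mul_le_mul_of_nonneg_left (norm_le_sum_abs x) hlam.le
    exact hl1.trans (le_add_of_nonneg_left (by positivity))
  obtain ⟨a, ha⟩ := (continuous_objective Φ y lam).exists_forall_le hcoercive
  exact ⟨a, isMinOn_univ_iff.2 ha⟩

lemma le_of_forall_mul_le_mul_add_sq {p r k : ℝ}
    (h : ∀ θ ∈ Ioc (0 : ℝ) 1, θ * p ≤ θ * r + θ ^ 2 * k) : p ≤ r := by
  have hlim : Tendsto (fun θ : ℝ => r + θ * k) (𝓝[>] 0) (𝓝 (r + 0 * k)) :=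
    (Continuous.tendsto (by fun_prop) 0).mono_left nhdsWithin_le_nhds
  rw [zero_mul, add_zero] at hlim
  refine ge_of_tendsto hlim (eventually_of_mem (Ioc_mem_nhdsGT one_pos) fun θ hθ => ?_)
  refine le_of_mul_le_mul_left ?_ hθ.1
  linarith [h θ hθ]

lemma inner_le_of_isMinOn_objective (hlam : 0 ≤ lam) {a : EuclideanSpace ℝ (Fin N)}
    (ha : IsMinOn (objective Φ y lam) univ a) (x : EuclideanSpace ℝ (Fin N)) :
    inner ℝ (x - a) (mulE Φ.transpose (y - mulE Φ a)) ≤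
      lam * ∑ n, |x n| - lam * ∑ n, |a n| := by
  refine le_of_forall_mul_le_mul_add_sq (k := 1 / 2 * ‖mulE Φ (x - a)‖ ^ 2) fun θ hθ => ?_
  have hl1 : ∑ n, |(a + θ • (x - a)) n| ≤ (1 - θ) * ∑ n, |a n| + θ * ∑ n, |x n| := by
    rw [Finset.mul_sum, Finset.mul_sum, ← Finset.sum_add_distrib]
    refine Finset.sum_le_sum fun n _ => ?_
    calc |(a + θ • (x - a)) n| = |(1 - θ) * a n + θ * x n| := by
          simp only [PiLp.add_apply, PiLp.smul_apply, PiLp.sub_apply, smul_eq_mul]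
          ring_nf
      _ ≤ |(1 - θ) * a n| + |θ * x n| := abs_add_le _ _
      _ = (1 - θ) * |a n| + θ * |x n| := by
          rw [abs_mul, abs_mul, abs_of_nonneg (sub_nonneg.2 hθ.2), abs_of_pos hθ.1]
  have hmin := sub_nonneg.2 (isMinOn_univ_iff.1 ha (a + θ • (x - a)))
  rw [objective_sub_objective, add_sub_cancel_left, mulE_smul, norm_smul, mul_pow,
    Real.norm_eq_abs, sq_abs, real_inner_smul_left] at hmin
  linarith [mul_le_mul_of_nonneg_left hl1 hlam]

lemma exists_field_eq_zero_of_isMinOn (hlam : 0 ≤ lam) {a : EuclideanSpace ℝ (Fin N)}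
    (ha : IsMinOn (objective Φ y lam) univ a) : ∃ w, field Φ y lam w = 0 ∧ output lam w = a := by
  set r := mulE Φ.transpose (y - mulE Φ a)
  set p := output lam (a + r) with hp
  have hpa : p = a := by
    have hfirst := inner_le_of_isMinOn_objective hlam ha p
    have hsub := inner_sub_output_le hlam (a + r) a
    rw [← hp, add_sub_right_comm, inner_add_right, real_inner_self_eq_norm_sq, ← neg_sub p a,
      inner_neg_left, norm_neg] at hsub
    exact sub_eq_zero.1 (norm_eq_zero.1 (pow_eq_zero_iff two_ne_zero |>.1
      (le_antisymm (by linarith) (sq_nonneg _))))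
  refine ⟨a + r, field_eq_zero_iff.2 ?_, hpa⟩
  rw [← hp, hpa, add_sub_cancel_left]

end Optimality

section Convergence

variable {M N : ℕ} {Φ : Matrix (Fin M) (Fin N) ℝ} {y : EuclideanSpace ℝ (Fin M)} {lam τ : ℝ}

/-- The Bregman divergence of `v ↦ ‖output lam v‖ ^ 2 / 2`. For a fixed point `w`, it is a Lyapunov
function `v ↦ divergence lam v w` of the dynamics. -/
noncomputable def divergence (lam : ℝ) (v w : EuclideanSpace ℝ (Fin N)) : ℝ :=
  ∑ n, bregman lam (v n) (w n)

/-- The rate at which `divergence lam · w`, for a fixed point `w`, decreases along the field. -/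
noncomputable def dissipation (Φ : Matrix (Fin M) (Fin N) ℝ) (lam : ℝ)
    (v w : EuclideanSpace ℝ (Fin N)) : ℝ :=
  ‖mulE Φ (output lam v - output lam w)‖ ^ 2 +
    inner ℝ (output lam v - output lam w) ((v - w) - (output lam v - output lam w))

lemma half_norm_output_sub_sq_le_divergence (hlam : 0 ≤ lam) (v w : EuclideanSpace ℝ (Fin N)) :
    ‖output lam v - output lam w‖ ^ 2 / 2 ≤ divergence lam v w := by
  rw [EuclideanSpace.real_norm_sq_eq, Finset.sum_div]
  exact Finset.sum_le_sum fun n _ => half_sq_le_bregman hlam (v n) (w n)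

lemma divergence_nonneg (hlam : 0 ≤ lam) (v w : EuclideanSpace ℝ (Fin N)) :
    0 ≤ divergence lam v w :=
  Finset.sum_nonneg fun n _ => bregman_nonneg hlam (v n) (w n)

lemma divergence_eq_zero (hlam : 0 ≤ lam) {v w : EuclideanSpace ℝ (Fin N)}
    (h : output lam v = output lam w) : divergence lam v w = 0 :=
  Finset.sum_eq_zero fun n _ => bregman_eq_zero hlam (congrArg (fun x => x n) h)

lemma continuous_divergence (hlam : 0 ≤ lam) (w : EuclideanSpace ℝ (Fin N)) :
    Continuous fun v => divergence lam v w := by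
  have hT := continuous_softThreshold hlam
  unfold divergence bregman
  fun_prop

lemma hasDerivWithinAt_divergence (hlam : 0 ≤ lam) {u : ℝ → EuclideanSpace ℝ (Fin N)}
    {u' : EuclideanSpace ℝ (Fin N)} {D : Set ℝ} {t : ℝ} (hu : HasDerivWithinAt u u' D t)
    (w : EuclideanSpace ℝ (Fin N)) :
    HasDerivWithinAt (fun x => divergence lam (u x) w)
      (inner ℝ (output lam (u t) - output lam w) u') D t := by
  rw [real_inner_eq_sum]
  refine HasDerivWithinAt.fun_sum fun n _ => ?_
  have hn : HasDerivWithinAt (fun x => u x n) (u' n) D t :=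
    (EuclideanSpace.proj (𝕜 := ℝ) n).hasFDerivAt.comp_hasDerivWithinAt t hu
  exact (hasDerivAt_bregman hlam (u t n) (w n)).comp_hasDerivWithinAt t hn

lemma dissipation_nonneg (Φ : Matrix (Fin M) (Fin N) ℝ) (hlam : 0 ≤ lam)
    (v w : EuclideanSpace ℝ (Fin N)) : 0 ≤ dissipation Φ lam v w := by
  refine add_nonneg (sq_nonneg _) ?_
  rw [real_inner_eq_sum]
  exact Finset.sum_nonneg fun n _ => softThreshold_sub_mul_nonneg hlam (v n) (w n)

lemma continuous_dissipation (Φ : Matrix (Fin M) (Fin N) ℝ) (hlam : 0 ≤ lam)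
    (w : EuclideanSpace ℝ (Fin N)) : Continuous fun v => dissipation Φ lam v w := by
  have hout := continuous_output (N := N) hlam
  have hΦ := continuous_mulE Φ
  unfold dissipation
  fun_prop

lemma inner_output_sub_field {w : EuclideanSpace ℝ (Fin N)} (hw : field Φ y lam w = 0)
    (v : EuclideanSpace ℝ (Fin N)) :
    inner ℝ (output lam v - output lam w) (field Φ y lam v) = -dissipation Φ lam v w := by
  rw [← sub_zero (field Φ y lam v), ← hw, field_sub_field, mulE_gram_sub_one, dissipation,
    ← real_inner_self_eq_norm_sq, ← inner_mulE_transpose]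
  simp only [inner_sub_right, inner_neg_right]
  ring

lemma isMinOn_objective_of_dissipation_eq_zero (hlam : 0 ≤ lam)
    {v w : EuclideanSpace ℝ (Fin N)} (hw : field Φ y lam w = 0)
    (hvw : dissipation Φ lam v w = 0) : IsMinOn (objective Φ y lam) univ (output lam v) := by
  have hle : objective Φ y lam (output lam v) ≤ objective Φ y lam (output lam w) := by
    rw [← sub_nonpos, objective_sub_objective, ← field_eq_zero_iff.1 hw]
    have hsub := inner_sub_output_le hlam v (output lam w)
    rw [dissipation] at hvw
    simp only [inner_sub_right, inner_sub_left] at hsub hvw ⊢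
    linarith [sq_nonneg ‖mulE Φ (output lam v - output lam w)‖]
  exact isMinOn_univ_iff.2 fun x =>
    hle.trans (isMinOn_univ_iff.1 (isMinOn_objective_output hlam hw) x)

variable {u : ℝ → EuclideanSpace ℝ (Fin N)} {w : EuclideanSpace ℝ (Fin N)}

lemma IsTrajectory.divergence_le (hu : IsTrajectory Φ y lam τ u) (hlam : 0 ≤ lam) (hτ : 0 < τ)
    (hw : field Φ y lam w = 0) {s t m : ℝ} (hs : 0 ≤ s) (hst : s ≤ t)
    (hm : ∀ x, 0 ≤ x → m ≤ dissipation Φ lam (u x) w) :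
    divergence lam (u t) w ≤ divergence lam (u s) w - m / τ * (t - s) := by
  have hderiv (x : ℝ) (hx : x ∈ interior (Ici 0)) :
      HasDerivAt (fun x => divergence lam (u x) w) (-(dissipation Φ lam (u x) w / τ)) x := by
    rw [interior_Ici] at hx
    refine ((hasDerivWithinAt_divergence hlam (hu.hasDerivWithinAt hτ.ne' hx.le) w).hasDerivAt
      (Ici_mem_nhds hx)).congr_deriv ?_
    rw [real_inner_smul_right, inner_output_sub_field hw]
    ring
  have hmean := (convex_Ici (0 : ℝ)).image_sub_le_mul_sub_of_deriv_le
    ((continuous_divergence hlam w).comp_continuousOn hu.continuousOn)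
    (fun x hx => (hderiv x hx).differentiableAt.differentiableWithinAt) (C := -(m / τ))
    (fun x hx => (hderiv x hx).deriv.trans_le <| neg_le_neg <|
      div_le_div_of_nonneg_right (hm x (interior_subset hx)) hτ.le)
    s hs t (hs.trans hst) hst
  simp only [Function.comp_apply] at hmean
  linarith

lemma IsTrajectory.divergence_antitoneOn (hu : IsTrajectory Φ y lam τ u) (hlam : 0 ≤ lam)
    (hτ : 0 < τ) (hw : field Φ y lam w = 0) :
    AntitoneOn (fun t => divergence lam (u t) w) (Ici 0) := fun s hs t _ hst => by
  simpa using hu.divergence_le hlam hτ hw hs hst fun x _ => dissipation_nonneg Φ hlam (u x) w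

lemma IsTrajectory.exists_dissipation_eq_zero (hu : IsTrajectory Φ y lam τ u) (hlam : 0 ≤ lam)
    (hτ : 0 < τ) (hb : Bornology.IsBounded (u '' Ici 0)) (hw : field Φ y lam w = 0) :
    ∃ v ∈ closure (u '' Ici 0), dissipation Φ lam v w = 0 := by
  have horbit (x : ℝ) (hx : 0 ≤ x) : u x ∈ closure (u '' Ici 0) :=
    subset_closure (mem_image_of_mem u hx)
  obtain ⟨v, hv, hmin⟩ := hb.isCompact_closure.exists_isMinOn ⟨u 0, horbit 0 le_rfl⟩
    (continuous_dissipation Φ hlam w).continuousOn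
  refine ⟨v, hv, le_antisymm (not_lt.1 fun hpos => ?_) (dissipation_nonneg Φ hlam v w)⟩
  set m := dissipation Φ lam v w
  set d := divergence lam (u 0) w
  have hd : 0 ≤ d := divergence_nonneg hlam _ _
  -- a time at which a dissipation rate of at least `m` would have made the divergence negative
  set t := (d + 1) * τ / m with ht
  have hle : divergence lam (u t) w ≤ d - m / τ * (t - 0) :=
    hu.divergence_le hlam hτ hw le_rfl (by positivity) fun x hx => hmin (horbit x hx)
  have hdrop : m / τ * (t - 0) = d + 1 := by
    rw [ht, sub_zero]
    field_simp
  linarith [divergence_nonneg hlam (u t) w]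

lemma IsTrajectory.tendsto_output (hu : IsTrajectory Φ y lam τ u) (hlam : 0 ≤ lam) (hτ : 0 < τ)
    (hw : field Φ y lam w = 0) {v : EuclideanSpace ℝ (Fin N)} (hv : v ∈ closure (u '' Ici 0))
    (hvw : output lam v = output lam w) :
    Tendsto (fun t => output lam (u t)) atTop (𝓝 (output lam w)) := by
  rw [tendsto_iff_norm_sub_tendsto_zero, Metric.tendsto_atTop]
  intro e he
  have hopen : IsOpen {x | divergence lam x w < e ^ 2 / 2} :=
    isOpen_Iio.preimage (continuous_divergence hlam w)
  have hmem : divergence lam v w < e ^ 2 / 2 := by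
    rw [divergence_eq_zero hlam hvw]
    positivity
  obtain ⟨_, hs_lt, s, hs, rfl⟩ := mem_closure_iff.1 hv _ hopen hmem
  refine ⟨s, fun t hst => ?_⟩
  rw [Real.dist_eq, sub_zero, abs_norm]
  have hanti := hu.divergence_antitoneOn hlam hτ hw hs (hs.trans hst : (0 : ℝ) ≤ t) hst
  have hnorm := half_norm_output_sub_sq_le_divergence hlam (u t) w
  refine lt_of_pow_lt_pow_left₀ 2 he.le ?_
  linarith [mem_ofPred_eq ▸ hs_lt]

lemma IsTrajectory.hasDerivWithinAt_sub (hu : IsTrajectory Φ y lam τ u) (hτ : τ ≠ 0)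
    (hw : field Φ y lam w = 0) {t : ℝ} (ht : 0 ≤ t) :
    HasDerivWithinAt (fun t => u t - w)
      (-τ⁻¹ • mulE (Φ.transpose * Φ - 1) (output lam (u t) - output lam w) - τ⁻¹ • (u t - w))
      (Ici 0) t := by
  refine ((hu.hasDerivWithinAt hτ ht).sub_const w).congr_deriv ?_
  rw [← sub_zero (field Φ y lam (u t)), ← hw, field_sub_field]
  module

lemma IsTrajectory.tendsto_of_tendsto_output (hu : IsTrajectory Φ y lam τ u) (hτ : 0 < τ)
    (hw : field Φ y lam w = 0)
    (hout : Tendsto (fun t => output lam (u t)) atTop (𝓝 (output lam w))) :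
    Tendsto u atTop (𝓝 w) := by
  refine tendsto_sub_nhds_zero_iff.1 (tendsto_zero_of_hasDerivWithinAt_sub_smul (inv_pos.2 hτ)
    (fun t ht => hu.hasDerivWithinAt_sub hτ.ne' hw ht) ?_)
  have hdiff : Tendsto (fun t => mulE (Φ.transpose * Φ - 1) (output lam (u t) - output lam w))
      atTop (𝓝 (mulE (Φ.transpose * Φ - 1) 0)) :=
    ((continuous_mulE _).tendsto 0).comp (tendsto_sub_nhds_zero_iff.2 hout)
  simpa only [mulE_zero, smul_zero] using hdiff.const_smul (-τ⁻¹)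

lemma IsTrajectory.exists_tendsto (hu : IsTrajectory Φ y lam τ u) (hlam : 0 < lam) (hτ : 0 < τ)
    (hb : Bornology.IsBounded (u '' Ici 0)) :
    ∃ w, field Φ y lam w = 0 ∧ Tendsto u atTop (𝓝 w) := by
  obtain ⟨a, ha⟩ := exists_isMinOn_objective Φ y hlam
  obtain ⟨z, hz, -⟩ := exists_field_eq_zero_of_isMinOn hlam.le ha
  obtain ⟨v, hv, hvz⟩ := hu.exists_dissipation_eq_zero hlam.le hτ hb hz
  obtain ⟨w, hw, hwv⟩ := exists_field_eq_zero_of_isMinOn hlam.le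
    (isMinOn_objective_of_dissipation_eq_zero hlam.le hz hvz)
  exact ⟨w, hw, hu.tendsto_of_tendsto_output hτ hw
    (hu.tendsto_output hlam.le hτ hw hv hwv.symm)⟩

lemma IsTrajectory.eq_of_apply_zero_eq (hu : IsTrajectory Φ y lam τ u) (hlam : 0 ≤ lam)
    (hτ : 0 < τ) (hw : field Φ y lam w = 0) (hu0 : u 0 = w) {t : ℝ} (ht : 0 ≤ t) : u t = w := by
  have hout (x : ℝ) (hx : 0 ≤ x) : output lam (u x) - output lam w = 0 := by
    have hanti := hu.divergence_antitoneOn hlam hτ hw self_mem_Ici hx hx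
    simp only [hu0, divergence_eq_zero hlam rfl] at hanti
    have hnorm := half_norm_output_sub_sq_le_divergence hlam (u x) w
    rw [← norm_eq_zero, ← pow_eq_zero_iff two_ne_zero]
    exact le_antisymm (by linarith) (sq_nonneg _)
  have hnorm := norm_le_of_hasDerivWithinAt_sub_smul (μ := 0) (η := 0) (inv_pos.2 hτ)
    (fun z hz => hu.hasDerivWithinAt_sub hτ.ne' hw hz)
    (fun z hz => by simp [hout z hz, mulE_zero]) ht
  rw [hu0] at hnorm
  simpa [sub_eq_zero] using hnorm

end Convergence

section ExponentialRate

variable {M N k : ℕ} {Φ : Matrix (Fin M) (Fin N) ℝ} {y : EuclideanSpace ℝ (Fin M)}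
  {lam τ δ : ℝ} {u : ℝ → EuclideanSpace ℝ (Fin N)} {w : EuclideanSpace ℝ (Fin N)}

lemma eventually_activeSet_subset (hu : Tendsto u atTop (𝓝 w)) :
    ∀ᶠ t in atTop, activeSet lam (u t) ⊆ Finset.univ.filter fun n => lam ≤ |w n| := by
  have hoff : ∀ n, ¬lam ≤ |w n| → ∀ᶠ t in atTop, |u t n| < lam := fun n hn =>
    (((PiLp.continuous_apply 2 _ n).tendsto w).comp hu).abs.eventually_lt_const (not_le.1 hn)
  filter_upwards [eventually_all.2 fun n => eventually_imp_distrib_left.2 (hoff n)] with t ht n hn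
  rw [Finset.mem_filter_univ]
  exact by_contra fun hwn => (ht n hwn).not_gt (mem_activeSet.1 hn)

lemma output_sub_apply_eq_zero (hlam : 0 ≤ lam) {s : Finset (Fin N)}
    {v : EuclideanSpace ℝ (Fin N)} (hv : activeSet lam v ⊆ s) (hw : activeSet lam w ⊆ s) {n : Fin N}
    (hn : n ∉ s) : (output lam v - output lam w) n = 0 := by
  rw [PiLp.sub_apply, (output_apply_eq_zero_iff hlam).2 fun h => hn (hv h),
    (output_apply_eq_zero_iff hlam).2 fun h => hn (hw h), sub_zero]

lemma RIP.inner_restrict_field_le (h : RIP Φ k δ) (hlam : 0 ≤ lam) {s : Finset (Fin N)}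
    (hs : s.card ≤ k) {v : EuclideanSpace ℝ (Fin N)} (hv : activeSet lam v ⊆ s)
    (hws : activeSet lam w ⊆ s) (hw : field Φ y lam w = 0) :
    inner ℝ (restrict s (v - w)) (field Φ y lam v) ≤ -((1 - δ) * ‖restrict s (v - w)‖ ^ 2) := by
  have hgram := h.inner_restrict_gram_le hs (v := v - w) (z := output lam v - output lam w)
    (fun n hn => output_sub_apply_eq_zero hlam hv hws hn)
    (fun n _ => abs_softThreshold_sub_le hlam (v n) (w n))
  rwa [← sub_zero (field Φ y lam v), ← hw, field_sub_field, mulE_gram_sub_one, ← sub_add,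
    sub_add_eq_add_sub]

lemma IsTrajectory.isBigO_output_sub (hu : IsTrajectory Φ y lam τ u) (hlam : 0 ≤ lam)
    (hτ : 0 < τ) (hRIP : RIP Φ k δ) (hw : field Φ y lam w = 0) (hlim : Tendsto u atTop (𝓝 w))
    (hk : (Finset.univ.filter fun n => lam ≤ |w n|).card ≤ k) :
    (fun t => output lam (u t) - output lam w) =O[atTop]
      fun t => Real.exp (-((1 - δ) / τ * t)) := by
  set G := Finset.univ.filter fun n => lam ≤ |w n|
  have hwG : activeSet lam w ⊆ G := activeSet_subset_filter_le lam w
  obtain ⟨T, hT⟩ := eventually_atTop.1 (eventually_activeSet_subset (lam := lam) hlim)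
  set s := max T 0
  have hs : 0 ≤ s := le_max_right T 0
  have huG (t : ℝ) (ht : s ≤ t) : activeSet lam (u t) ⊆ G := hT t ((le_max_left T 0).trans ht)
  have hdecay (t : ℝ) (ht : s ≤ t) : ‖restrict G (u t - w)‖ ≤
      ‖restrict G (u s - w)‖ * Real.exp (-((1 - δ) / τ * (t - s))) := by
    refine norm_le_mul_exp_of_inner_deriv_le (x := fun t => restrict G (u t - w))
      (x' := fun t => restrict G (τ⁻¹ • field Φ y lam (u t))) (fun z hz => ?_) (fun z hz => ?_) ht
    · exact (restrict G).hasFDerivAt.comp_hasDerivWithinAt z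
        (((hu.hasDerivWithinAt hτ.ne' (hs.trans hz)).mono (Ici_subset_Ici.2 hs)).sub_const w)
    · rw [inner_restrict_restrict, real_inner_smul_right]
      refine (mul_le_mul_of_nonneg_left (hRIP.inner_restrict_field_le hlam hk (huG z hz) hwG hw)
        (inv_nonneg.2 hτ.le)).trans_eq ?_
      ring
  refine IsBigO.of_bound (‖restrict G (u s - w)‖ * Real.exp ((1 - δ) / τ * s)) ?_
  filter_upwards [eventually_ge_atTop s] with t ht
  have hout : ‖output lam (u t) - output lam w‖ ≤ ‖restrict G (u t - w)‖ :=
    norm_le_norm_restrict (fun n hn => output_sub_apply_eq_zero hlam (huG t ht) hwG hn)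
      fun n _ => abs_softThreshold_sub_le hlam (u t n) (w n)
  refine (hout.trans (hdecay t ht)).trans_eq ?_
  rw [Real.norm_eq_abs, Real.abs_exp, mul_assoc, ← Real.exp_add]
  ring_nf

lemma IsTrajectory.exists_norm_sub_le_exp (hu : IsTrajectory Φ y lam τ u) (hlam : 0 ≤ lam)
    (hτ : 0 < τ) (hRIP : RIP Φ k δ) (hw : field Φ y lam w = 0) (hlim : Tendsto u atTop (𝓝 w))
    (hk : (Finset.univ.filter fun n => lam ≤ |w n|).card ≤ k) :
    ∃ K : ℝ, 0 < K ∧ ∀ t : ℝ, 0 ≤ t → ‖u t - w‖ ≤ K * Real.exp (-((1 - δ) * t / τ)) := by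
  have hrate : (1 - δ) / τ < τ⁻¹ := by
    rw [div_eq_mul_inv]
    exact mul_lt_of_lt_one_left (inv_pos.2 hτ) (sub_lt_self 1 hRIP.1)
  have hdrive := ((isBigO_mulE (Φ.transpose * Φ - 1) _ _).trans
    (hu.isBigO_output_sub hlam hτ hRIP hw hlim hk)).const_smul_left (-τ⁻¹)
  have hstate := isBigO_exp_of_hasDerivWithinAt_sub_smul hrate
    (fun t ht => hu.hasDerivWithinAt_sub hτ.ne' hw ht) hdrive
  simp only [mul_div_right_comm]
  exact exists_pos_forall_norm_le_of_isBigO (hu.continuousOn.sub continuousOn_const)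
    (by fun_prop) (fun t => Real.exp_pos _) hstate

end ExponentialRate

section Threshold

variable {M N k q : ℕ} {Φ : Matrix (Fin M) (Fin N) ℝ} {y : EuclideanSpace ℝ (Fin M)}
  {lam τ δ : ℝ} {u : ℝ → EuclideanSpace ℝ (Fin N)}

lemma field_zero (Φ : Matrix (Fin M) (Fin N) ℝ) (hlam : 0 ≤ lam) : field Φ 0 lam 0 = 0 := by
  rw [field_eq_zero_iff, output_zero hlam, mulE_zero, sub_zero, sub_zero, mulE_zero]

lemma one_sub_three_mul_div_lt_one_sub (hδ0 : 0 < δ) (hδ1 : δ < 1) :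
    (1 - 3 * δ) / (1 - δ) < 1 - δ := by
  rw [div_lt_iff₀ (sub_pos.2 hδ1)]
  linarith [mul_pos hδ0 hδ0]

lemma one_sub_mul_sqrt_one_add_le (hδ0 : 0 ≤ δ) (hδ1 : δ ≤ 1) :
    (1 - δ) * √(1 + δ) ≤ (1 + δ) * √(1 - δ) := by
  have hsub : 0 ≤ 1 - δ := sub_nonneg.2 hδ1
  have hadd : 0 ≤ 1 + δ := by positivity
  calc (1 - δ) * √(1 + δ) = √(1 - δ) * √(1 - δ) * √(1 + δ) := by rw [Real.mul_self_sqrt hsub]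
    _ ≤ √(1 - δ) * √(1 + δ) * √(1 + δ) := by
        gcongr
        linarith
    _ = (1 + δ) * √(1 - δ) := by rw [mul_assoc, Real.mul_self_sqrt hadd, mul_comm]

lemma RIP.sqrt_mul_norm_mulE_add_le (h : RIP Φ k δ) (hδ : δ < 1 / 3)
    {x : EuclideanSpace ℝ (Fin N)} (hx : l0 x ≤ k) (ε : EuclideanSpace ℝ (Fin M)) {c : ℝ}
    (hc : (1 + δ) / (1 - 3 * δ) * (‖x‖ + √(1 - δ) * ‖ε‖) ≤ c) :
    √(1 + δ) * ‖mulE Φ x + ε‖ ≤ (1 - 3 * δ) / (1 - δ) * c := by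
  have hδ0 := h.1
  have hδ1 := h.2.1
  have hnorm : ‖mulE Φ x + ε‖ ≤ √(1 + δ) * ‖x‖ + ‖ε‖ :=
    (norm_add_le _ _).trans (add_le_add_left (h.norm_mulE_le hx) _)
  have hsqrt : √(1 + δ) * √(1 + δ) = 1 + δ := Real.mul_self_sqrt (by positivity)
  rw [div_mul_eq_mul_div, div_le_iff₀ (by linarith)] at hc
  rw [div_mul_eq_mul_div, le_div_iff₀ (sub_pos.2 hδ1)]
  calc √(1 + δ) * ‖mulE Φ x + ε‖ * (1 - δ)
      ≤ √(1 + δ) * (√(1 + δ) * ‖x‖ + ‖ε‖) * (1 - δ) := by gcongr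
    _ = (1 - δ) * (√(1 + δ) * √(1 + δ) * ‖x‖) + (1 - δ) * √(1 + δ) * ‖ε‖ := by ring
    _ = (1 - δ) * ((1 + δ) * ‖x‖) + (1 - δ) * √(1 + δ) * ‖ε‖ := by rw [hsqrt]
    _ ≤ (1 + δ) * ‖x‖ + (1 + δ) * √(1 - δ) * ‖ε‖ :=
        add_le_add (mul_le_of_le_one_left (by positivity) (by linarith)) <|
          mul_le_mul_of_nonneg_right (one_sub_mul_sqrt_one_add_le hδ0.le hδ1.le) (norm_nonneg ε)
    _ ≤ (1 - 3 * δ) * c := by linarith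

lemma IsTrajectory.mem_topBall_of_RIP (hu : IsTrajectory Φ y lam τ u) (hRIP : RIP Φ q δ)
    (hq : 0 < q) (hlam : 0 ≤ lam) (hτ : 0 < τ) (hu0 : ‖u 0‖ ≤ lam * √q)
    (hy : √(1 + δ) * ‖y‖ < (1 - δ) * (lam * √q)) {t : ℝ} (ht : 0 ≤ t) :
    u t ∈ topBall q (lam * √q) := by
  refine hu.mem_topBall hτ (fun v hv s hs hsc => ?_) (mem_topBall_of_norm_le hu0) ht
  have hactive : activeSet lam v ⊆ s :=
    activeSet_subset_of_forall_norm_restrict_le hlam hs (card_activeSet_lt hq hlam hv)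
      fun s' hs' => (hv s' hs').trans_eq hsc.symm
  exact hRIP.inner_restrict_field_neg hlam hy hs hactive hsc.ge

lemma IsTrajectory.exists_fixedPoint_norm_sub_le_exp (hu : IsTrajectory Φ y lam τ u)
    (hRIP : RIP Φ q δ) (hq : 0 < q) (hlam : 0 < lam) (hτ : 0 < τ)
    (hball : ∀ t, 0 ≤ t → u t ∈ topBall q (lam * √q))
    (hy : √(1 + δ) * ‖y‖ < (1 - δ) * (lam * √q)) :
    ∃ w, field Φ y lam w = 0 ∧
      ∃ K : ℝ, 0 < K ∧ ∀ t : ℝ, 0 ≤ t → ‖u t - w‖ ≤ K * Real.exp (-((1 - δ) * t / τ)) := by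
  obtain ⟨w, hw, hlim⟩ := hu.exists_tendsto hlam hτ
    ((isBounded_topBall hq).subset (image_subset_iff.2 hball))
  have hwball : w ∈ topBall q (lam * √q) :=
    isClosed_topBall.mem_of_tendsto hlim ((eventually_ge_atTop 0).mono hball)
  have hcard : (Finset.univ.filter fun n => lam ≤ |w n|).card ≤ q :=
    card_le_of_field_eq_zero hlam.le
      (fun v s hs hv hc => hRIP.inner_restrict_field_neg hlam.le hy hs hv hc) hw
      (card_activeSet_lt hq hlam.le hwball).le
  exact ⟨w, hw, hu.exists_norm_sub_le_exp hlam.le hτ hRIP hw hlim hcard⟩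

end Threshold

end LCA

theorem theorem3_general {M N : ℕ} (Φ : Matrix (Fin M) (Fin N) ℝ) (q : ℕ) (δ ρ : ℝ)
    (hRIP : LCA.RIP Φ q δ) (hρ : ρ < 1 - δ) (y : EuclideanSpace ℝ (Fin M))
    (lam τ : ℝ) (hlam : 0 ≤ lam) (hτ : 0 < τ)
    (u : ℝ → EuclideanSpace ℝ (Fin N)) (hu : LCA.IsTrajectory Φ y lam τ u)
    (hu0 : ‖u 0‖ ≤ lam * √q) (hy : √(1 + δ) * ‖y‖ ≤ ρ * (lam * √q)) :
    (∀ t : ℝ, 0 ≤ t → (LCA.activeSet lam (u t)).card ≤ q) ∧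
    (∃ uStar : EuclideanSpace ℝ (Fin N),
      LCA.field Φ y lam uStar = 0 ∧
      IsMinOn (LCA.objective Φ y lam) Set.univ (LCA.output lam uStar) ∧
      ∃ K : ℝ, 0 < K ∧ ∀ t : ℝ, 0 ≤ t →
        ‖u t - uStar‖ ≤ K * Real.exp (-((1 - δ) * t / τ))) := by
  rcases (norm_nonneg (u 0)).trans hu0 |>.eq_or_lt with hc | hc
  · rw [← hc, mul_zero] at hy
    rw [← hc, norm_le_zero_iff] at hu0
    have hδ : 0 < √(1 + δ) := Real.sqrt_pos.2 (by linarith [hRIP.1])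
    obtain rfl : y = 0 := norm_le_zero_iff.1 (nonpos_of_mul_nonpos_right hy hδ)
    have hfield := LCA.field_zero Φ hlam
    have hu_zero (t : ℝ) (ht : 0 ≤ t) : u t = 0 := hu.eq_of_apply_zero_eq hlam hτ hfield hu0 ht
    refine ⟨fun t ht => ?_, 0, hfield, LCA.isMinOn_objective_output hlam hfield, 1, one_pos,
      fun t ht => ?_⟩
    · rw [hu_zero t ht, LCA.activeSet_zero hlam, Finset.card_empty]
      exact Nat.zero_le q
    · rw [hu_zero t ht, sub_zero, norm_zero]
      positivity
  · have hlam_pos : 0 < lam := pos_of_mul_pos_left hc (Real.sqrt_nonneg q)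
    have hq : 0 < q := Nat.cast_pos.1 (Real.sqrt_pos.1 (pos_of_mul_pos_right hc hlam))
    have hy_lt := hy.trans_lt (mul_lt_mul_of_pos_right hρ hc)
    have hball (t : ℝ) (ht : 0 ≤ t) := hu.mem_topBall_of_RIP hRIP hq hlam hτ hu0 hy_lt ht
    obtain ⟨w, hw, hK⟩ := hu.exists_fixedPoint_norm_sub_le_exp hRIP hq hlam_pos hτ hball hy_lt
    exact ⟨fun t ht => (LCA.card_activeSet_lt hq hlam (hball t ht)).le, w, hw,
      LCA.isMinOn_objective_output hlam hw, hK⟩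

theorem theorem3 {M N : ℕ} (Φ : Matrix (Fin M) (Fin N) ℝ) (S q : ℕ) (δ : ℝ)
    (hRIP : LCA.RIP Φ (S + q) δ) (hδ : δ < 1 / 3)
    (aDag : EuclideanSpace ℝ (Fin N)) (hS : LCA.l0 aDag = S)
    (ε y : EuclideanSpace ℝ (Fin M)) (hy : y = LCA.mulE Φ aDag + ε)
    (lam τ : ℝ) (hlam : 0 ≤ lam) (hτ : 0 < τ)
    (u : ℝ → EuclideanSpace ℝ (Fin N)) (hu : LCA.IsTrajectory Φ y lam τ u)
    (hu0 : ‖u 0‖ ≤ lam * Real.sqrt q)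
    (hthr : (1 + δ) / (1 - 3 * δ) * (‖aDag‖ + Real.sqrt (1 - δ) * ‖ε‖) ≤ lam * Real.sqrt q) :
    (∀ t : ℝ, 0 ≤ t → (LCA.activeSet lam (u t)).card ≤ q) ∧
    (∃ uStar : EuclideanSpace ℝ (Fin N),
      LCA.field Φ y lam uStar = 0 ∧
      IsMinOn (LCA.objective Φ y lam) Set.univ (LCA.output lam uStar) ∧
      ∃ K : ℝ, 0 < K ∧ ∀ t : ℝ, 0 ≤ t →
        ‖u t - uStar‖ ≤ K * Real.exp (-((1 - δ) * t / τ))) :=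
  theorem3_general Φ q δ _ (hRIP.mono (Nat.le_add_left q S))
    (LCA.one_sub_three_mul_div_lt_one_sub hRIP.1 hRIP.2.1) y lam τ hlam hτ u hu hu0
    (hy ▸ hRIP.sqrt_mul_norm_mulE_add_le hδ (hS.trans_le (Nat.le_add_right S q)) ε hthr)
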